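/- Let $\mathbb{K}=\mathbb{R}$ or $\mathbb{K}=\mathbb{C}$. For a Banach space $X$ over $\mathbb{K}$ and a finite-dimensional subspace $Y\subset X$, let $\lambda_{\mathbb K}(Y,X)$ be the infimum of $\|P\|$ over all continuous linear projections $P$ of $X$ onto $Y$. Let $\lambda_{\mathbb K}(Y)$ be the supremum of $\lambda_{\mathbb K}(Y,X)$ over all Banach spaces $X$ containing $Y$ isometrically, and let $\lambda_{\mathbb K}(m)$ be the supremum of $\lambda_{\mathbb K}(Y)$ over all $Y$ with $\dim Y=m$. For positive integers $N\ge m$ put $$\delta_{m,N}=\frac{m}{N}\left(1+\sqrt{\frac{(N-1)(N-m)}{m}}\right).$$ An equiangular tight frame of $N$ vectors in $\mathbb{K}^m$ is a system $u_1,\dots,u_N$ of unit vectors of $\mathbb{K}^m$ (with the Euclidean norm) such that $|\langle u_i,u_j\rangle|$ is the same for all $i\ne j$ and, for some $\alpha>0$, $\|x\|^2=\alpha\sum_{k=1}^N|\langle x,u_k\rangle|^2$ for all $x\in\mathbb{K}^m$. It is called maximal if $N=\frac{m(m+1)}{2}$ when $\mathbb{K}=\mathbb{R}$, and if $N=m^2$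 when $\mathbb{K}=\mathbb{C}$. **Theorem.** Let $m>1$ be an integer. Then 1. $\displaystyle\lambda_{\mathbb R}(m)\le\delta_{m,\frac{m(m+1)}{2}}=\frac{2}{m+1}\left(1+\frac{m-1}{2}\sqrt{m+2}\right)$; 2. $\displaystyle\lambda_{\mathbb C}(m)\le\delta_{m,m^2}=\frac1m\left(1+(m-1)\sqrt{m+1}\right)$. Moreover, for $\mathbb{K}=\mathbb{R}$ and for $\mathbb{K}=\mathbb{C}$ alike, the inequality is an equality if there exists a maximal equiangular tight frame in $\mathbb{K}^m$. -/

import Mathlib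

open scoped ENNReal

universe u

/-- The relative projection constant `λ(Y, X)`: the infimum of the operator norms of all continuous
linear projections `P : X → Y` of the normed space `X` onto its subspace `Y`. It is valued in
`[0, ∞]`, so that no boundedness or non-emptiness convention intervenes. -/
noncomputable def relProjConst (𝕜 : Type) [RCLike 𝕜] {X : Type u} [NormedAddCommGroup X]
    [NormedSpace 𝕜 X] (Y : Submodule 𝕜 X) : ℝ≥0∞ :=
  ⨅ (P : X →L[𝕜] Y) (_ : ∀ y : Y, P (y : X) = y), ‖P‖ₑ

/-- The absolute projection constant `λ(Y)`: the supremum of `λ(Y, X)` over all Banach spaces `X`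
containing `Y` isometrically. -/
noncomputable def absProjConst (𝕜 : Type) [RCLike 𝕜] (Y : Type u) [NormedAddCommGroup Y]
    [NormedSpace 𝕜 Y] : ℝ≥0∞ :=
  ⨆ (X : Type u) (_ : NormedAddCommGroup X) (_ : NormedSpace 𝕜 X) (_ : CompleteSpace X)
    (ι : Y →ₗᵢ[𝕜] X), relProjConst 𝕜 (LinearMap.range ι.toLinearMap)

/-- The maximal absolute projection constant `λ_𝕜(m)`: the supremum of `λ(Y)` over all
`m`-dimensional normed spaces `Y` over `𝕜`. -/
noncomputable def maxAbsProjConst (𝕜 : Type) [RCLike 𝕜] (m : ℕ) : ℝ≥0∞ :=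
  ⨆ (Y : Type u) (_ : NormedAddCommGroup Y) (_ : NormedSpace 𝕜 Y) (_ : FiniteDimensional 𝕜 Y)
    (_ : Module.finrank 𝕜 Y = m), absProjConst 𝕜 Y

/-- `δ_{m,N} = (m / N) (1 + √((N - 1)(N - m) / m))`. -/
noncomputable def deltaBound (m N : ℕ) : ℝ :=
  (m : ℝ) / N * (1 + Real.sqrt (((N : ℝ) - 1) * ((N : ℝ) - m) / m))

/-- The system `v 0, …, v (N - 1)` of vectors of `𝕜 ^ m` is a tight frame. -/
def IsTightFrame (𝕜 : Type) [RCLike 𝕜] {m N : ℕ} (v : Fin N → EuclideanSpace 𝕜 (Fin m)) : Prop :=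
  ∃ α : ℝ, 0 < α ∧ ∀ x : EuclideanSpace 𝕜 (Fin m), ‖x‖ ^ 2 = α * ∑ k, ‖inner 𝕜 x (v k)‖ ^ 2

/-- The system `v 0, …, v (N - 1)` of vectors of `𝕜 ^ m` is an equiangular tight frame. -/
structure IsETF (𝕜 : Type) [RCLike 𝕜] {m N : ℕ} (v : Fin N → EuclideanSpace 𝕜 (Fin m)) :
    Prop where
  unit : ∀ i, ‖v i‖ = 1
  tight : IsTightFrame 𝕜 v
  equiangular : ∃ c : ℝ, ∀ i j, i ≠ j → ‖inner 𝕜 (v i) (v j)‖ = c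

/-- A maximal equiangular tight frame exists in `ℝ ^ m`: one of `m (m + 1) / 2` vectors. -/
def ExistsMaximalETFReal (m : ℕ) : Prop :=
  ∃ v : Fin (m * (m + 1) / 2) → EuclideanSpace ℝ (Fin m), IsETF ℝ v

/-- A maximal equiangular tight frame exists in `ℂ ^ m`: one of `m ^ 2` vectors. -/
def ExistsMaximalETFComplex (m : ℕ) : Prop :=
  ∃ v : Fin (m ^ 2) → EuclideanSpace ℂ (Fin m), IsETF ℂ v

/-! Upper bound. Up to a factor close to 1, finitely many functionals embed the `m`-dimensional
space into a finite sup-norm space, and Hahn-Banach extends these functionals to any superspace.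
What remains is a projection matrix with small row sums. By convex separation
(`exists_leftInverse_row_sum_lt`) it is enough to control weighted averages of the row sums. For
given weights, the projection orthogonal in the weighted ℓ² product turns the average into `∑ t i *
t j * |⟨u i, u j⟩|`, with `u` a Parseval frame and `t` a unit vector
(`exists_leftInverse_weighted_sum_le`).

`sum_mul_norm_inner_le` bounds that sum. A normalized inner product `s ∈ [0, 1]` is majorized by an
even quartic that is exact at `s = c` and `s = 1`, the only values occurring in a maximal
equiangular tight frame. The Parseval identity controls the quadratic term. The quartic term is
controlled by Cauchy-Schwarz, since the tensors `x ⊗ conj x` live in dimension `m ^ 2`, or `m * (m +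
1) / 2` for symmetric real tensors.

Lower bound. For an equiangular tight frame, trace duality against the sign matrix of the Gram
matrix gives the same estimate for every projection onto the range of the analysis map
(`deltaBound_le_norm_projection_of_equiangular`). -/

/-! ### Fourth-order frame potentials -/

open scoped ComplexConjugate in
/-- If every vector `Z i` is fixed by the matrix `S`, then the weighted trace of the Gram matrix of
`Z` is controlled by its weighted Hilbert-Schmidt norm and the Hilbert-Schmidt norm of `S`. -/
theorem sq_sum_norm_sq_le_of_fixed {𝕜 : Type*} [RCLike 𝕜] {ι κ : Type*} [Fintype ι] [Fintype κ]
    (q : ι → ℝ) (Z : ι → κ → 𝕜) (S : κ → κ → 𝕜) (hS : ∀ i a, ∑ b, S a b * Z i b = Z i a) :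
    (∑ i, q i * ∑ a, ‖Z i a‖ ^ 2) ^ 2 ≤ (∑ a, ∑ b, ‖S a b‖ ^ 2) *
      ∑ i, ∑ j, q i * q j * ‖∑ a, conj (Z i a) * Z j a‖ ^ 2 := by
  -- `M` is the weighted second-moment matrix. Its pairing with `S` is the weighted trace, and its
  -- squared Hilbert-Schmidt norm is the double sum, so Cauchy-Schwarz finishes.
  set M : κ → κ → 𝕜 := fun a b => ∑ i, (q i : 𝕜) * (conj (Z i a) * Z i b) with hM
  have h1 : ((∑ i, q i * ∑ a, ‖Z i a‖ ^ 2 : ℝ) : 𝕜) = ∑ a, ∑ b, S a b * M a b := by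
    push_cast
    simp only [hM, Finset.mul_sum]
    rw [Finset.sum_comm]
    refine Finset.sum_congr rfl fun a _ => ?_
    rw [Finset.sum_comm]
    refine Finset.sum_congr rfl fun i _ => ?_
    rw [← RCLike.conj_mul]
    calc (q i : 𝕜) * (conj (Z i a) * Z i a)
        = (q i : 𝕜) * (conj (Z i a) * ∑ b, S a b * Z i b) := by rw [hS i a]
      _ = _ := by
        rw [Finset.mul_sum, Finset.mul_sum]
        exact Finset.sum_congr rfl fun b _ => by ring
  have h2 : ∑ p : κ × κ, ‖M p.1 p.2‖ ^ 2
      = ∑ i, ∑ j, q i * q j * ‖∑ a, conj (Z i a) * Z j a‖ ^ 2 := by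
    apply RCLike.ofReal_injective (K := 𝕜)
    push_cast
    have e1 : ∀ a b, (‖M a b‖ : 𝕜) ^ 2 = ∑ r : ι × ι, (q r.1 : 𝕜) * q r.2 *
        (Z r.1 a * conj (Z r.2 a) * (conj (Z r.1 b) * Z r.2 b)) := by
      intro a b
      rw [← RCLike.conj_mul, hM]
      simp only [map_sum, map_mul, RCLike.conj_conj, RCLike.conj_ofReal]
      rw [Finset.sum_mul_sum, ← Fintype.sum_prod_type']
      exact Finset.sum_congr rfl fun r _ => by ring
    have e2 : ∀ i j, (q i : 𝕜) * q j * (‖∑ a, conj (Z i a) * Z j a‖ : 𝕜) ^ 2 =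
        ∑ p : κ × κ, (q i : 𝕜) * q j *
          (Z i p.1 * conj (Z j p.1) * (conj (Z i p.2) * Z j p.2)) := by
      intro i j
      rw [← RCLike.conj_mul]
      simp only [map_sum, map_mul, RCLike.conj_conj]
      rw [Finset.sum_mul_sum, ← Fintype.sum_prod_type', Finset.mul_sum]
    simp only [e1, e2]
    rw [Finset.sum_comm, Fintype.sum_prod_type]
  have h3 : ‖∑ a, ∑ b, S a b * M a b‖ ≤ ∑ p : κ × κ, ‖S p.1 p.2‖ * ‖M p.1 p.2‖ := by
    rw [← Fintype.sum_prod_type']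
    refine (norm_sum_le _ _).trans (le_of_eq ?_)
    simp [norm_mul]
  have h4 := Finset.sum_mul_sq_le_sq_mul_sq Finset.univ (fun p : κ × κ => ‖S p.1 p.2‖)
    (fun p => ‖M p.1 p.2‖)
  have h5 : (∑ i, q i * ∑ a, ‖Z i a‖ ^ 2) ^ 2 = ‖∑ a, ∑ b, S a b * M a b‖ ^ 2 := by
    rw [← h1, RCLike.norm_ofReal, sq_abs]
  rw [h5, ← h2, ← Fintype.sum_prod_type' (fun a b => ‖S a b‖ ^ 2)]
  refine le_trans ?_ h4
  gcongr

open scoped ComplexConjugate in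
/-- Weighted fourth-order frame potential bound for unit vectors, in terms of a matrix `S` that
fixes all the tensors `x i ⊗ conj (x i) - γ`. -/
theorem sq_sum_le_of_fixed_tensor {𝕜 : Type*} [RCLike 𝕜] {ι : Type*} [Fintype ι] {m : ℕ}
    (q : ι → ℝ) (x : ι → EuclideanSpace 𝕜 (Fin m)) (hx : ∀ i, ‖x i‖ = 1) (γ : ℝ)
    (S : Fin m × Fin m → Fin m × Fin m → 𝕜)
    (hS : ∀ i a, ∑ b, S a b * (x i b.1 * conj (x i b.2) - if b.1 = b.2 then (γ : 𝕜) else 0) =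
      x i a.1 * conj (x i a.2) - if a.1 = a.2 then (γ : 𝕜) else 0) :
    ((1 - (2 * γ - m * γ ^ 2)) * ∑ i, q i) ^ 2 ≤ (∑ a, ∑ b, ‖S a b‖ ^ 2) *
      ∑ i, ∑ j, q i * q j * (‖inner 𝕜 (x i) (x j)‖ ^ 2 - (2 * γ - m * γ ^ 2)) ^ 2 := by
  set Z : ι → Fin m × Fin m → 𝕜 :=
    fun i b => x i b.1 * conj (x i b.2) - if b.1 = b.2 then (γ : 𝕜) else 0 with hZ
  have hself : ∀ i, ∑ k, conj (x i k) * x i k = 1 := by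
    intro i
    have h := EuclideanSpace.norm_sq_eq (x i)
    rw [hx i] at h
    simp only [RCLike.conj_mul]
    rw [← RCLike.ofReal_one (K := 𝕜), ← one_pow 2, h]
    push_cast
    rfl
  have hself' : ∀ i, ∑ k, x i k * conj (x i k) = 1 := fun i => by
    rw [← hself i]; exact Finset.sum_congr rfl fun _ _ => mul_comm _ _
  -- Subtracting `γ` times the identity lowers every inner product of tensors by the same constant,
  -- because each tensor has trace 1.
  have key : ∀ i j, ∑ a, conj (Z i a) * Z j a =
      ((‖inner 𝕜 (x i) (x j)‖ ^ 2 - (2 * γ - m * γ ^ 2) : ℝ) : 𝕜) := by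
    intro i j
    have hin : ((‖inner 𝕜 (x i) (x j)‖ ^ 2 : ℝ) : 𝕜) =
        (∑ k, conj (x i k) * x j k) * ∑ l, x i l * conj (x j l) := by
      push_cast
      rw [← RCLike.mul_conj, PiLp.inner_apply]
      simp only [RCLike.inner_apply, map_sum, map_mul, RCLike.conj_conj]
      congr 1 <;> exact Finset.sum_congr rfl fun _ _ => mul_comm _ _
    rw [RCLike.ofReal_sub, hin, Fintype.sum_prod_type]
    simp only [hZ, map_sub, map_mul, RCLike.conj_conj, apply_ite conj, RCLike.conj_ofReal, map_zero,
      sub_mul, mul_sub, Finset.sum_sub_distrib, mul_ite, ite_mul, mul_zero, zero_mul,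
      Finset.sum_ite_eq, Finset.mem_univ, if_true]
    have e1 : ∑ k, conj (x i k) * x i k * (γ : 𝕜) = γ := by
      rw [← Finset.sum_mul, hself, one_mul]
    have e2 : ∑ k, (γ : 𝕜) * (x j k * conj (x j k)) = γ := by
      rw [← Finset.mul_sum, hself', mul_one]
    rw [e1, e2, Finset.sum_mul_sum]
    have e3 : ∀ k l, conj (x i k) * x i l * (x j k * conj (x j l)) =
      conj (x i k) * x j k * (x i l * conj (x j l)) := fun k l => by ring
    simp only [e3]
    push_cast
    simp
    ring
  have hnorm : ∀ i, ∑ a, ‖Z i a‖ ^ 2 = 1 - (2 * γ - m * γ ^ 2) := by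
    intro i
    apply RCLike.ofReal_injective (K := 𝕜)
    have := key i i
    rw [inner_self_eq_norm_sq_to_K, hx i] at this
    simp only [RCLike.conj_mul] at this
    push_cast at this ⊢
    simpa using this
  have main := sq_sum_norm_sq_le_of_fixed q Z S hS
  simp only [hnorm, key, RCLike.norm_ofReal, sq_abs] at main
  rwa [← Finset.sum_mul, mul_comm] at main

/-- No symmetry is available in general, so `S` is the identity on all tensors, of squared norm `m ^
2`. -/
theorem sq_sum_le_sq_mul_frame_potential {𝕜 : Type*} [RCLike 𝕜] {ι : Type*} [Fintype ι] {m : ℕ}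
    (q : ι → ℝ) (x : ι → EuclideanSpace 𝕜 (Fin m)) (hx : ∀ i, ‖x i‖ = 1) (γ : ℝ) :
    ((1 - (2 * γ - m * γ ^ 2)) * ∑ i, q i) ^ 2 ≤ (m : ℝ) ^ 2 *
      ∑ i, ∑ j, q i * q j * (‖inner 𝕜 (x i) (x j)‖ ^ 2 - (2 * γ - m * γ ^ 2)) ^ 2 := by
  refine (sq_sum_le_of_fixed_tensor q x hx γ (fun a b => if a = b then 1 else 0) ?_).trans_eq ?_
  · intro i a
    simp only [ite_mul, one_mul, zero_mul, Finset.sum_ite_eq, Finset.mem_univ, if_true]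
  · congr 1
    simp [apply_ite norm, ite_pow, sq]

/-- Real tensors `x ⊗ x` are symmetric, so `S` can be the symmetrizer, an orthogonal projection
whose squared norm is its rank `m * (m + 1) / 2`. -/
theorem sq_sum_le_choose_mul_frame_potential {ι : Type*} [Fintype ι] {m : ℕ}
    (q : ι → ℝ) (x : ι → EuclideanSpace ℝ (Fin m)) (hx : ∀ i, ‖x i‖ = 1) (γ : ℝ) :
    ((1 - (2 * γ - m * γ ^ 2)) * ∑ i, q i) ^ 2 ≤ ((m : ℝ) * (m + 1) / 2) *
      ∑ i, ∑ j, q i * q j * (‖inner ℝ (x i) (x j)‖ ^ 2 - (2 * γ - m * γ ^ 2)) ^ 2 := by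
  refine (sq_sum_le_of_fixed_tensor q x hx γ
    (fun a b => ((if a = b then 1 else 0) + (if a.swap = b then 1 else 0)) / 2) ?_).trans_eq ?_
  · intro i a
    simp only [add_div, add_mul, Finset.sum_add_distrib, ite_div, zero_div, ite_mul, zero_mul,
      Finset.sum_ite_eq, Finset.mem_univ, if_true, Prod.fst_swap, Prod.snd_swap,
      @eq_comm _ a.2 a.1]
    simp
    ring
  · congr 1
    have h : ∀ a b : Fin m × Fin m,
        ‖((if a = b then (1 : ℝ) else 0) + (if a.swap = b then 1 else 0)) / 2‖ ^ 2 =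
        (if a = b then 1 / 4 else 0) + (if a.swap = b then 1 / 4 else 0) +
          (if a = b then (if a.swap = a then 1 / 2 else 0) else 0) := by
      intro a b
      rw [Real.norm_eq_abs, sq_abs]
      by_cases h1 : a = b
      · subst h1
        by_cases h2 : a.swap = a <;> simp [h2] <;> norm_num
      · by_cases h2 : a.swap = b <;> simp [h1, h2]
        norm_num
    simp only [h, Finset.sum_add_distrib, Finset.sum_ite_eq, Finset.mem_univ, if_true]
    have h2 : ∑ a : Fin m × Fin m, (if a.swap = a then (1 / 2 : ℝ) else 0) = m / 2 := by
      rw [Fintype.sum_prod_type]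
      simp only [Prod.swap_prod_mk, Prod.mk.injEq]
      have : ∀ k l : Fin m, (if l = k ∧ k = l then (1 / 2 : ℝ) else 0) =
          if k = l then 1 / 2 else 0 := fun k l => by
        congr 1; simp [eq_comm]
      simp only [this, Finset.sum_ite_eq, Finset.mem_univ, if_true]
      simp [div_eq_mul_inv]
    rw [h2]
    simp
    ring

/-! ### First absolute moments of Parseval frames -/

theorem sum_norm_sq_of_parseval {𝕜 : Type*} [RCLike 𝕜] {ι : Type*} [Fintype ι] {m : ℕ}
    (u : ι → EuclideanSpace 𝕜 (Fin m)) (α : ℝ) (hu : ∀ x, ‖x‖ ^ 2 = α * ∑ i, ‖inner 𝕜 x (u i)‖ ^ 2) :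
    (m : ℝ) = α * ∑ i, ‖u i‖ ^ 2 := by
  have h : ∀ k : Fin m, (1 : ℝ) = α * ∑ i, ‖u i k‖ ^ 2 := fun k => by
    have := hu (EuclideanSpace.single k (1 : 𝕜))
    simpa [EuclideanSpace.inner_single_left] using this
  have h2 : ∑ _k : Fin m, (1 : ℝ) = ∑ k : Fin m, α * ∑ i, ‖u i k‖ ^ 2 :=
    Finset.sum_congr rfl fun k _ => h k
  rw [← Finset.mul_sum, Finset.sum_comm] at h2
  simpa [EuclideanSpace.norm_sq_eq] using h2

/-- The defect is `(s - c) ^ 2 * (1 - (s + c) ^ 2 / (1 + c) ^ 2)`, which vanishes exactly where an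
equiangular frame needs it: at `s = c` and `s = 1`. -/
theorem two_mul_mul_le_sub_sq_div {c s : ℝ} (hc : 0 < c) (hs0 : 0 ≤ s) (hs1 : s ≤ 1) :
    2 * c * s ≤ c ^ 2 + s ^ 2 - (s ^ 2 - c ^ 2) ^ 2 / (1 + c) ^ 2 := by
  have h : (s ^ 2 - c ^ 2) ^ 2 / (1 + c) ^ 2 ≤ (s - c) ^ 2 := by
    rw [div_le_iff₀ (by positivity)]
    have : (s ^ 2 - c ^ 2) ^ 2 = (s - c) ^ 2 * (s + c) ^ 2 := by ring
    rw [this]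
    gcongr
  linarith [sq_nonneg (s - c)]

/-- The weighted first absolute moment of the Gram matrix of a Parseval frame is bounded by means of
a bound for its fourth-order frame potential. -/
theorem sum_mul_norm_inner_le {𝕜 : Type*} [RCLike 𝕜] {ι : Type*} [Fintype ι] {m : ℕ} {d c : ℝ}
    (hm : 0 < m) (hd : 0 < d) (hc : 0 < c) (hcd : (1 - c) ^ 2 ≤ d * c ^ 2)
    (hcm : c ^ 2 * (m * (d - 1)) = d - m)
    (hpot : ∀ (q : ι → ℝ) (x : ι → EuclideanSpace 𝕜 (Fin m)), (∀ i, ‖x i‖ = 1) →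
      ((1 - c ^ 2) * ∑ i, q i) ^ 2 ≤
        d * ∑ i, ∑ j, q i * q j * (‖inner 𝕜 (x i) (x j)‖ ^ 2 - c ^ 2) ^ 2)
    (u : ι → EuclideanSpace 𝕜 (Fin m)) (hu : ∀ x, ∑ i, ‖inner 𝕜 x (u i)‖ ^ 2 = ‖x‖ ^ 2)
    (t : ι → ℝ) (ht0 : ∀ i, 0 ≤ t i) (ht : ∑ i, t i ^ 2 = 1) :
    ∑ i, ∑ j, t i * t j * ‖inner 𝕜 (u i) (u j)‖ ≤ m * (1 / d + (1 - 1 / d) * c) := by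
  have hm' : (0 : ℝ) < m := by exact_mod_cast hm
  -- A zero vector gets an arbitrary unit direction; its weight `q i` vanishes.
  have hx : ∀ i, ∃ x : EuclideanSpace 𝕜 (Fin m), ‖x‖ = 1 ∧ u i = (‖u i‖ : 𝕜) • x := by
    intro i
    by_cases h : u i = 0
    · exact ⟨EuclideanSpace.single ⟨0, hm⟩ 1, by simp, by simp [h]⟩
    · refine ⟨(‖u i‖ : 𝕜)⁻¹ • u i, ?_, ?_⟩
      · rw [norm_smul, norm_inv, RCLike.norm_ofReal, abs_norm,
          inv_mul_cancel₀ (norm_ne_zero_iff.2 h)]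
      · rw [smul_inv_smul₀]
        exact RCLike.ofReal_ne_zero.2 (norm_ne_zero_iff.2 h)
  choose x hx1 hxu using hx
  set s : ι → ι → ℝ := fun i j => ‖inner 𝕜 (x i) (x j)‖ with hs
  set q : ι → ℝ := fun i => t i * ‖u i‖ with hq
  have hq0 : ∀ i, 0 ≤ q i := fun i => mul_nonneg (ht0 i) (norm_nonneg _)
  have hs0 : ∀ i j, 0 ≤ s i j := fun i j => norm_nonneg _
  have hs1 : ∀ i j, s i j ≤ 1 := fun i j => by
    simpa [hx1] using norm_inner_le_norm (𝕜 := 𝕜) (x i) (x j)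
  have hsu : ∀ i j, ‖inner 𝕜 (x i) (u j)‖ = ‖u j‖ * s i j := fun i j => by
    conv_lhs => rw [hxu j]
    rw [inner_smul_right, norm_mul, RCLike.norm_ofReal, abs_norm]
  have hLHS : ∀ i j, t i * t j * ‖inner 𝕜 (u i) (u j)‖ = q i * q j * s i j := fun i j => by
    conv_lhs => rw [hxu i]
    rw [inner_smul_left, norm_mul, hsu, RCLike.conj_ofReal, RCLike.norm_ofReal, abs_norm]
    simp only [hq]
    ring
  have hum : ∑ i, ‖u i‖ ^ 2 = m := by
    simpa using (sum_norm_sq_of_parseval u 1 fun x => by rw [hu, one_mul]).symm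
  have hQ : (∑ i, q i) ^ 2 ≤ m := by
    have := Finset.sum_mul_sq_le_sq_mul_sq Finset.univ t (fun i => ‖u i‖)
    rwa [ht, hum, one_mul] at this
  have hrow : ∀ i, ∑ j, ‖u j‖ ^ 2 * s i j ^ 2 = 1 := fun i => by
    have := hu (x i)
    simp only [hsu, hx1, mul_pow, one_pow] at this
    exact this
  have hcol : ∑ i, ∑ j, t i ^ 2 * (‖u j‖ ^ 2 * s i j ^ 2) = 1 := by
    simp only [← Finset.mul_sum, hrow, mul_one, ht]
  have hsymm : ∀ i j, s i j = s j i := fun i j => norm_inner_symm _ _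
  -- AM-GM on `q i * q j = (t i * ‖u j‖) * (t j * ‖u i‖)`; both resulting sums equal 1 by Parseval.
  have hA : ∑ i, ∑ j, q i * q j * s i j ^ 2 ≤ 1 := by
    have hcol' : ∑ i, ∑ j, t j ^ 2 * (‖u i‖ ^ 2 * s j i ^ 2) = 1 := by
      rw [Finset.sum_comm]; exact hcol
    have hle : ∑ i, ∑ j, q i * q j * s i j ^ 2 ≤
        ∑ i, ∑ j, (t i ^ 2 * (‖u j‖ ^ 2 * s i j ^ 2) + t j ^ 2 * (‖u i‖ ^ 2 * s j i ^ 2)) / 2 := by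
      refine Finset.sum_le_sum fun i _ => Finset.sum_le_sum fun j _ => ?_
      rw [hsymm j i]
      have := mul_nonneg (sq_nonneg (t i * ‖u j‖ - t j * ‖u i‖)) (sq_nonneg (s i j))
      simp only [hq]
      linarith
    refine hle.trans_eq ?_
    simp only [← Finset.sum_div, Finset.sum_add_distrib, hcol, hcol']
    norm_num
  have hB := hpot q x hx1
  set B := ∑ i, ∑ j, q i * q j * (‖inner 𝕜 (x i) (x j)‖ ^ 2 - c ^ 2) ^ 2 with hBdef
  set Q := ∑ i, q i with hQdef
  set A := ∑ i, ∑ j, q i * q j * s i j ^ 2 with hAdef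
  have hsum : 2 * c * ∑ i, ∑ j, q i * q j * s i j ≤ c ^ 2 * Q ^ 2 + A - B / (1 + c) ^ 2 := by
    have hQ2 : Q ^ 2 = ∑ i, ∑ j, q i * q j := by rw [sq, hQdef, Finset.sum_mul_sum]
    rw [hQ2, hAdef, hBdef]
    simp only [Finset.mul_sum, Finset.sum_div]
    simp only [← Finset.sum_add_distrib, ← Finset.sum_sub_distrib]
    refine Finset.sum_le_sum fun i _ => Finset.sum_le_sum fun j _ => ?_
    have := mul_le_mul_of_nonneg_left (two_mul_mul_le_sub_sq_div hc (hs0 i j) (hs1 i j))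
      (mul_nonneg (hq0 i) (hq0 j))
    refine le_trans (le_of_eq ?_) (this.trans (le_of_eq ?_)) <;> ring
  have hB' : (1 - c) ^ 2 * Q ^ 2 / d ≤ B / (1 + c) ^ 2 := by
    rw [div_le_div_iff₀ hd (by positivity)]
    calc (1 - c) ^ 2 * Q ^ 2 * (1 + c) ^ 2 = ((1 - c ^ 2) * Q) ^ 2 := by ring
      _ ≤ B * d := hB.trans_eq (mul_comm _ _)
  -- The sign matters: only an upper bound for `Q ^ 2` is known.
  have hcoef : 0 ≤ c ^ 2 - (1 - c) ^ 2 / d := by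
    rw [sub_nonneg, div_le_iff₀ hd]
    linarith
  have h1 : (c ^ 2 - (1 - c) ^ 2 / d) * Q ^ 2 ≤ (c ^ 2 - (1 - c) ^ 2 / d) * m :=
    mul_le_mul_of_nonneg_left hQ hcoef
  have h2 : (c ^ 2 - (1 - c) ^ 2 / d) * m + 1 = 2 * c * (m * (1 / d + (1 - 1 / d) * c)) := by
    field_simp
    linear_combination -hcm
  have h3 : (1 - c) ^ 2 * Q ^ 2 / d = (1 - c) ^ 2 / d * Q ^ 2 := by ring
  simp only [hLHS]
  refine le_of_mul_le_mul_left ?_ (by positivity : 0 < 2 * c)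
  rw [← h2]
  linarith

/-! ### Choice of constants in the real and complex cases -/

/-- Produces the shift `γ` that makes the tensors pair to `|⟨x, y⟩| ^ 2 - c ^ 2`. The left side has
maximum `1 / m`, whence the hypothesis. -/
theorem exists_two_mul_sub_mul_sq_eq {m c : ℝ} (hm : 0 < m) (h : m * c ^ 2 ≤ 1) :
    ∃ γ : ℝ, 2 * γ - m * γ ^ 2 = c ^ 2 := by
  refine ⟨(1 - √(1 - m * c ^ 2)) / m, ?_⟩
  have := Real.sq_sqrt (sub_nonneg.2 h)
  field_simp
  linear_combination -this

theorem deltaBound_eq {m N : ℕ} {c : ℝ} (hm : 0 < m) (hN : 0 < N) (hc : 0 ≤ c)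
    (h : c ^ 2 * (m * ((N : ℝ) - 1)) = N - m) :
    deltaBound m N = m * (1 / N + (1 - 1 / N) * c) := by
  have hm' : (0 : ℝ) < m := by exact_mod_cast hm
  have hN' : (1 : ℝ) ≤ N := by exact_mod_cast hN
  have hs : ((N : ℝ) - 1) * ((N : ℝ) - m) / m = ((N - 1) * c) ^ 2 := by
    rw [← h]; field_simp
  rw [deltaBound, hs, Real.sqrt_sq (mul_nonneg (by linarith) hc)]
  field_simp

theorem cast_mul_succ_div_two (m : ℕ) : ((m * (m + 1) / 2 : ℕ) : ℝ) = m * (m + 1) / 2 := by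
  rw [Nat.cast_div (even_iff_two_dvd.1 (Nat.even_mul_succ_self m)) (by norm_num)]
  push_cast
  ring

/-- Since `0 < c ≤ 1`, one has `(1 - c) ^ 2 ≤ 1 - c ^ 2 = k * c ^ 2`. -/
theorem one_sub_sq_le_of_mul_eq_one {c k d : ℝ} (hc : 0 < c) (hk : 0 ≤ k) (h : c ^ 2 * (k + 1) = 1)
    (hd : k ≤ d) : (1 - c) ^ 2 ≤ d * c ^ 2 := by
  have hc1 : c ≤ 1 := by nlinarith [mul_nonneg (sq_nonneg c) hk]
  nlinarith [mul_le_mul_of_nonneg_right hd (sq_nonneg c)]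

theorem sum_mul_norm_inner_le_real {ι : Type*} [Fintype ι] {m : ℕ} (hm : 1 < m)
    (u : ι → EuclideanSpace ℝ (Fin m)) (hu : ∀ x, ∑ i, ‖inner ℝ x (u i)‖ ^ 2 = ‖x‖ ^ 2)
    (t : ι → ℝ) (ht0 : ∀ i, 0 ≤ t i) (ht : ∑ i, t i ^ 2 = 1) :
    ∑ i, ∑ j, t i * t j * ‖inner ℝ (u i) (u j)‖ ≤ deltaBound m (m * (m + 1) / 2) := by
  have hm' : (2 : ℝ) ≤ m := by exact_mod_cast hm
  -- The common inner product forced on an equiangular tight frame of `m * (m + 1) / 2` vectors.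
  set c : ℝ := 1 / √(m + 2) with hcdef
  have hc : 0 < c := by positivity
  have hc2 : c ^ 2 * (m + 1 + 1) = 1 := by
    rw [hcdef, div_pow, Real.sq_sqrt (by positivity)]
    field_simp
    ring
  have hN : 0 < m * (m + 1) / 2 := Nat.div_pos (by nlinarith) (by norm_num)
  have hcm : c ^ 2 * (m * ((m : ℝ) * (m + 1) / 2 - 1)) = m * (m + 1) / 2 - m := by
    linear_combination (m * (m - 1) / 2 : ℝ) * hc2
  obtain ⟨γ, hγ⟩ := exists_two_mul_sub_mul_sq_eq (m := m) (c := c) (by linarith)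
    (by nlinarith [sq_nonneg c])
  rw [deltaBound_eq (by omega) hN hc.le (by rw [cast_mul_succ_div_two]; exact hcm),
    cast_mul_succ_div_two]
  refine sum_mul_norm_inner_le (by omega) (by positivity) hc
    (one_sub_sq_le_of_mul_eq_one hc (by positivity) hc2 (by nlinarith)) hcm ?_ u hu t ht0 ht
  intro q x hx
  rw [← hγ]
  exact sq_sum_le_choose_mul_frame_potential q x hx γ

theorem sum_mul_norm_inner_le_complex {ι : Type*} [Fintype ι] {m : ℕ} (hm : 1 < m)
    (u : ι → EuclideanSpace ℂ (Fin m)) (hu : ∀ x, ∑ i, ‖inner ℂ x (u i)‖ ^ 2 = ‖x‖ ^ 2)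
    (t : ι → ℝ) (ht0 : ∀ i, 0 ≤ t i) (ht : ∑ i, t i ^ 2 = 1) :
    ∑ i, ∑ j, t i * t j * ‖inner ℂ (u i) (u j)‖ ≤ deltaBound m (m ^ 2) := by
  have hm' : (2 : ℝ) ≤ m := by exact_mod_cast hm
  -- The corresponding value for `m ^ 2` vectors.
  set c : ℝ := 1 / √(m + 1) with hcdef
  have hc : 0 < c := by positivity
  have hc2 : c ^ 2 * (m + 1) = 1 := by
    rw [hcdef, div_pow, Real.sq_sqrt (by positivity)]
    field_simp
  have hcm : c ^ 2 * (m * ((m : ℝ) ^ 2 - 1)) = m ^ 2 - m := by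
    linear_combination (m * (m - 1) : ℝ) * hc2
  obtain ⟨γ, hγ⟩ := exists_two_mul_sub_mul_sq_eq (m := m) (c := c) (by linarith)
    (by nlinarith [sq_nonneg c])
  rw [deltaBound_eq (by omega) (by positivity) hc.le (by push_cast; exact hcm), Nat.cast_pow]
  refine sum_mul_norm_inner_le (by omega) (by positivity) hc
    (one_sub_sq_le_of_mul_eq_one hc (by positivity) hc2 (by nlinarith)) hcm ?_ u hu t ht0 ht
  intro q x hx
  rw [← hγ]
  exact sq_sum_le_sq_mul_frame_potential q x hx γ

theorem deltaBound_real {m : ℕ} (hm : 1 < m) : deltaBound m (m * (m + 1) / 2) =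
    2 / ((m : ℝ) + 1) * (1 + ((m : ℝ) - 1) / 2 * Real.sqrt ((m : ℝ) + 2)) := by
  have hm' : (2 : ℝ) ≤ m := by exact_mod_cast hm
  have h : ((m : ℝ) * (m + 1) / 2 - 1) * (m * (m + 1) / 2 - m) / m =
      (((m : ℝ) - 1) / 2) ^ 2 * (m + 2) := by
    field_simp
    ring
  rw [deltaBound, cast_mul_succ_div_two, h, Real.sqrt_mul (sq_nonneg _),
    Real.sqrt_sq (by linarith)]
  field_simp

theorem deltaBound_complex {m : ℕ} (hm : 1 < m) : deltaBound m (m ^ 2) =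
    1 / (m : ℝ) * (1 + ((m : ℝ) - 1) * Real.sqrt ((m : ℝ) + 1)) := by
  have hm' : (2 : ℝ) ≤ m := by exact_mod_cast hm
  have h : ((m : ℝ) ^ 2 - 1) * (m ^ 2 - m) / m = ((m : ℝ) - 1) ^ 2 * (m + 1) := by
    field_simp
    ring
  rw [deltaBound, Nat.cast_pow, h, Real.sqrt_mul (sq_nonneg _), Real.sqrt_sq (by linarith)]
  field_simp

/-! ### From frames to projections of small norm -/

/-- If the first absolute moments of all Parseval frames of `𝕜 ^ m` are bounded by `C`, then for
all positive weights `w` an `m`-dimensional space of functions on `ι` has a linear projection whose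
`w`-averaged row sums are at most `C`. -/
theorem exists_leftInverse_weighted_sum_le {𝕜 : Type*} [RCLike 𝕜] {m : ℕ} {C : ℝ}
    {ι : Type*} [Fintype ι] [DecidableEq ι]
    (hC : ∀ (u : ι → EuclideanSpace 𝕜 (Fin m)),
      (∀ x, ∑ i, ‖inner 𝕜 x (u i)‖ ^ 2 = ‖x‖ ^ 2) → ∀ t : ι → ℝ, (∀ i, 0 ≤ t i) →
      ∑ i, t i ^ 2 = 1 → ∑ i, ∑ j, t i * t j * ‖inner 𝕜 (u i) (u j)‖ ≤ C)
    {V : Type*} [AddCommGroup V] [Module 𝕜 V] (hV : Module.finrank 𝕜 V = m)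
    (T : V →ₗ[𝕜] ι → 𝕜) (hT : Function.Injective T) (w : ι → ℝ) (hw : ∀ i, 0 < w i) :
    ∃ R : (ι → 𝕜) →ₗ[𝕜] V, (∀ v, R (T v) = v) ∧
      ∑ i, w i * ∑ j, ‖T (R (Pi.single j 1)) i‖ ≤ C * ∑ i, w i := by
  have hsw : ∀ i, 0 < √(w i) := fun i => Real.sqrt_pos.2 (hw i)
  have hsw' : ∀ i, ((√(w i) : ℝ) : 𝕜) ≠ 0 := fun i => RCLike.ofReal_ne_zero.2 (hsw i).ne'
  -- `D` carries the weighted ℓ² product to the standard one, so `T ∘ R` below is the orthogonal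
  -- projection for the weights `w`.
  let D : (ι → 𝕜) →ₗ[𝕜] EuclideanSpace 𝕜 ι :=
    (WithLp.linearEquiv 2 𝕜 (ι → 𝕜)).symm.toLinearMap ∘ₗ
      LinearMap.pi fun i => ((√(w i) : ℝ) : 𝕜) • LinearMap.proj i
  have hD : ∀ a i, D a i = (√(w i) : ℝ) * a i := fun a i => by
    simp [D, RCLike.real_smul_eq_coe_mul]
  have hDinj : Function.Injective D := by
    intro a b hab
    funext i
    have := congrArg (fun z : EuclideanSpace 𝕜 ι => z i) hab
    simp only [hD] at this
    exact mul_left_cancel₀ (hsw' i) this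
  let E := LinearMap.range (D ∘ₗ T)
  let e : V ≃ₗ[𝕜] E := LinearEquiv.ofInjective (D ∘ₗ T) (hDinj.comp hT)
  have he : ∀ v, ((e v : E) : EuclideanSpace 𝕜 ι) = D (T v) := fun v =>
    LinearEquiv.ofInjective_apply (D ∘ₗ T) v
  let R : (ι → 𝕜) →ₗ[𝕜] V := e.symm.toLinearMap ∘ₗ E.orthogonalProjectionOnto.toLinearMap ∘ₗ D
  have hR : ∀ a, D (T (R a)) = (E.orthogonalProjectionOnto (D a) : EuclideanSpace 𝕜 ι) := by
    intro a
    rw [← he]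
    simp [R]
  refine ⟨R, fun v => ?_, ?_⟩
  · apply (hDinj.comp hT)
    simp only [Function.comp_apply, hR, ← he]
    simp
  rcases isEmpty_or_nonempty ι with hι | hι
  · simp
  have hfin : Module.finrank 𝕜 E = m := by rw [← hV]; exact e.symm.finrank_eq
  let b := (stdOrthonormalBasis 𝕜 E).reindex (finCongr hfin)
  let p : ι → E := fun i => E.orthogonalProjectionOnto (EuclideanSpace.single i 1)
  have hp : ∀ (z : E) i, inner 𝕜 (p i) z = (z : EuclideanSpace 𝕜 ι) i := fun z i => by
    simp only [p]
    rw [Submodule.inner_orthogonalProjectionOnto_eq_of_mem_right]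
    simp [EuclideanSpace.inner_single_left]
  set W := ∑ i, w i with hW
  have hWpos : 0 < W := Finset.sum_pos (fun i _ => hw i) Finset.univ_nonempty
  -- The projected standard basis is a Parseval frame of the range; `t i = √(w i / W)` symmetrizes
  -- the weights.
  have hmain := hC (fun i => b.repr (p i)) ?_ (fun i => √(w i) / √W) (fun i => by positivity) ?_
  · simp only [LinearIsometryEquiv.inner_map_map] at hmain
    have hterm : ∀ i j, w i * ‖T (R (Pi.single j 1)) i‖ =
        W * (√(w i) / √W * (√(w j) / √W) * ‖inner 𝕜 (p i) (p j)‖) := by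
      intro i j
      have h1 : D (Pi.single j 1) = ((√(w j) : ℝ) : 𝕜) • EuclideanSpace.single j (1 : 𝕜) := by
        ext k
        rw [hD]
        by_cases hk : k = j
        · subst hk; simp [RCLike.real_smul_eq_coe_mul]
        · simp [hk]
      have h2 : ((√(w i) : ℝ) : 𝕜) * T (R (Pi.single j 1)) i =
          (√(w j) : ℝ) * inner 𝕜 (p i) (p j) := by
        rw [← hD, hR, h1, hp]
        simp [p, RCLike.real_smul_eq_coe_mul]
      have h3 := congrArg norm h2
      rw [norm_mul, norm_mul, RCLike.norm_ofReal, RCLike.norm_ofReal, abs_of_pos (hsw i),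
        abs_of_pos (hsw j)] at h3
      have h4 : w i = √(w i) * √(w i) := (Real.mul_self_sqrt (hw i).le).symm
      have h5 : W = √W * √W := (Real.mul_self_sqrt hWpos.le).symm
      have h6 : 0 < √W := Real.sqrt_pos.2 hWpos
      calc w i * ‖T (R (Pi.single j 1)) i‖ = √(w i) * (√(w i) * ‖T (R (Pi.single j 1)) i‖) := by
            conv_lhs => rw [h4]
            ring
        _ = √(w i) * √(w j) * ‖inner 𝕜 (p i) (p j)‖ := by rw [h3]; ring
        _ = √W * √W * (√(w i) / √W * (√(w j) / √W) * ‖inner 𝕜 (p i) (p j)‖) := by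
            field_simp
        _ = _ := by rw [← h5]
    simp only [Finset.mul_sum, hterm]
    simp only [← Finset.mul_sum]
    rw [mul_comm C]
    exact mul_le_mul_of_nonneg_left hmain hWpos.le
  · intro x
    obtain ⟨z, rfl⟩ := b.repr.surjective x
    simp only [LinearIsometryEquiv.inner_map_map, LinearIsometryEquiv.norm_map]
    rw [Submodule.coe_norm, EuclideanSpace.norm_sq_eq]
    exact Finset.sum_congr rfl fun i _ => by rw [norm_inner_symm, hp]
  · simp only [div_pow, Real.sq_sqrt (hw _).le, Real.sq_sqrt hWpos.le]
    rw [← Finset.sum_div]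
    exact div_self hWpos.ne'

/-- Minimax step: bounds for all weighted averages of the row sums give a projection all of whose
row sums are bounded. -/
theorem exists_leftInverse_row_sum_lt {𝕜 : Type*} [RCLike 𝕜] {C C' : ℝ} (hCC' : C < C')
    {ι : Type*} [Fintype ι] [DecidableEq ι] {V : Type*} [AddCommGroup V] [Module 𝕜 V]
    (T : V →ₗ[𝕜] ι → 𝕜)
    (h : ∀ w : ι → ℝ, (∀ i, 0 < w i) → ∃ R : (ι → 𝕜) →ₗ[𝕜] V, (∀ v, R (T v) = v) ∧
      ∑ i, w i * ∑ j, ‖T (R (Pi.single j 1)) i‖ ≤ C * ∑ i, w i) :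
    ∃ R : (ι → 𝕜) →ₗ[𝕜] V, (∀ v, R (T v) = v) ∧ ∀ i, ∑ j, ‖T (R (Pi.single j 1)) i‖ < C' := by
  -- `A` is the upward closure of the attainable row-sum vectors. If it misses the open orthant `B`,
  -- a separating functional supplies weights contradicting `h`.
  set A : Set (ι → ℝ) := {g | ∃ R : (ι → 𝕜) →ₗ[𝕜] V, (∀ v, R (T v) = v) ∧
    ∀ i, ∑ j, ‖T (R (Pi.single j 1)) i‖ ≤ g i} with hA
  set B : Set (ι → ℝ) := Set.univ.pi fun _ => Set.Iio C' with hB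
  by_cases hdisj : Disjoint B A
  swap
  · obtain ⟨g, hgB, R, hR1, hR2⟩ := Set.not_disjoint_iff.1 hdisj
    exact ⟨R, hR1, fun i => (hR2 i).trans_lt (hgB i (Set.mem_univ i))⟩
  exfalso
  have hAconv : Convex ℝ A := by
    rintro g ⟨R, hR1, hR2⟩ g' ⟨R', hR1', hR2'⟩ a a' ha ha' haa
    refine ⟨(a : 𝕜) • R + (a' : 𝕜) • R', fun v => ?_, fun i => ?_⟩
    · simp only [LinearMap.add_apply, LinearMap.smul_apply, hR1, hR1', ← add_smul]
      rw [← RCLike.ofReal_add, haa, RCLike.ofReal_one, one_smul]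
    · calc _ ≤ ∑ j, (a * ‖T (R (Pi.single j 1)) i‖ + a' * ‖T (R' (Pi.single j 1)) i‖) := by
            refine Finset.sum_le_sum fun j _ => ?_
            simp only [LinearMap.add_apply, LinearMap.smul_apply, map_add, map_smul, Pi.add_apply,
              Pi.smul_apply]
            refine (norm_add_le _ _).trans_eq ?_
            rw [norm_smul, norm_smul, RCLike.norm_ofReal, RCLike.norm_ofReal, abs_of_nonneg ha,
              abs_of_nonneg ha']
        _ ≤ _ := by
            rw [Finset.sum_add_distrib, ← Finset.mul_sum, ← Finset.mul_sum]
            exact add_le_add (mul_le_mul_of_nonneg_left (hR2 i) ha)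
              (mul_le_mul_of_nonneg_left (hR2' i) ha')
  have hBconv : Convex ℝ B := convex_pi fun _ _ => convex_Iio C'
  have hBopen : IsOpen B := isOpen_set_pi Set.finite_univ fun _ _ => isOpen_Iio
  obtain ⟨f, s, hfB, hfA⟩ := geometric_hahn_banach_open hBconv hBopen hAconv hdisj
  set w : ι → ℝ := fun i => f (Pi.single i 1) with hw
  have hf : ∀ g : ι → ℝ, f g = ∑ i, w i * g i := by
    intro g
    conv_lhs => rw [← Finset.univ_sum_single g]
    rw [map_sum]
    refine Finset.sum_congr rfl fun i _ => ?_
    have : (Pi.single i (g i) : ι → ℝ) = g i • Pi.single i 1 := by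
      rw [← Pi.single_smul]; simp
    rw [this, map_smul, smul_eq_mul, mul_comm]
  have hconst : C * ∑ i, w i < s := by
    have := hfB (fun _ => C) (fun i _ => hCC')
    rwa [hf, ← Finset.sum_mul, mul_comm] at this
  -- `B` is unbounded below in each coordinate, so a negative weight would make `f` unbounded above
  -- on it.
  have hw0 : ∀ i, 0 ≤ w i := by
    intro i
    by_contra! hneg
    have hk : ∀ k : ℝ, 0 ≤ k → C * ∑ i, w i - k * w i < s := by
      intro k hk
      have hmem : (fun _ => C) - k • Pi.single i (1 : ℝ) ∈ B := by
        intro j _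
        have : (0 : ℝ) ≤ (k • Pi.single i (1 : ℝ) : ι → ℝ) j := by
          by_cases hj : j = i
          · subst hj; simpa using hk
          · simp [hj]
        exact (sub_le_self C this).trans_lt hCC'
      have := hfB _ hmem
      rw [map_sub, map_smul, hf, ← Finset.sum_mul, mul_comm] at this
      exact this
    have := hk ((s - C * ∑ i, w i) / (-w i)) (div_nonneg (by linarith) (by linarith))
    have h2 : (s - C * ∑ i, w i) / (-w i) * w i = -(s - C * ∑ i, w i) := by
      rw [div_mul_eq_mul_div, div_neg, mul_div_cancel_right₀ _ hneg.ne]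
    linarith
  -- Separation gives only nonnegative weights while `h` wants positive ones; they are raised by
  -- `η`, later taken small.
  have hη : ∀ η : ℝ, 0 < η → s ≤ C * ∑ i, w i + C * (Fintype.card ι) * η := by
    intro η hη
    obtain ⟨R, hR1, hR2⟩ := h (fun i => w i + η) (fun i => by linarith [hw0 i])
    have h1 := hfA _ ⟨R, hR1, fun i => le_rfl⟩
    rw [hf] at h1
    refine h1.trans (le_trans (Finset.sum_le_sum fun i _ => ?_) (hR2.trans_eq ?_))
    · exact mul_le_mul_of_nonneg_right (by linarith)
        (Finset.sum_nonneg fun _ _ => norm_nonneg _)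
    · rw [Finset.sum_add_distrib]
      simp
      ring
  have hK : 0 < |C * Fintype.card ι| + 1 := by positivity
  set gap := s - C * ∑ i, w i with hgap
  have hgap0 : 0 < gap := by linarith
  have h1 := hη (gap / (2 * (|C * Fintype.card ι| + 1))) (by positivity)
  have h2 : C * (Fintype.card ι) * (gap / (2 * (|C * Fintype.card ι| + 1))) ≤ gap / 2 := by
    have h3 : C * (Fintype.card ι) * (gap / (2 * (|C * Fintype.card ι| + 1))) ≤
        (|C * Fintype.card ι| + 1) * (gap / (2 * (|C * Fintype.card ι| + 1))) :=
      mul_le_mul_of_nonneg_right ((le_abs_self _).trans (by linarith)) (by positivity)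
    refine h3.trans_eq ?_
    field_simp
  linarith

/-- A finite-dimensional normed space is almost normed by finitely many functionals. -/
theorem exists_finset_dual_almost_norming (𝕜 : Type*) [RCLike 𝕜] {V : Type*} [NormedAddCommGroup V]
    [NormedSpace 𝕜 V] [FiniteDimensional 𝕜 V] {θ : ℝ} (hθ : 1 < θ) :
    ∃ (s : Finset V) (f : s → StrongDual 𝕜 V), (∀ i, ‖f i‖ ≤ 1) ∧
      ∀ (y : V) (r : ℝ), 0 ≤ r → (∀ i, ‖f i y‖ ≤ r) → ‖y‖ ≤ θ * r := by
  choose g hg1 hg2 using fun y : V => exists_dual_vector'' 𝕜 y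
  have hproper : ProperSpace V := FiniteDimensional.proper_rclike 𝕜 V
  -- Norming functionals of finitely many sphere points suffice, by compactness.
  obtain ⟨s, -, hs⟩ := (isCompact_sphere (0 : V) 1).elim_nhds_subcover
    (fun y => {z | 1 / θ < ‖g y z‖}) (by
      intro y hy
      refine (isOpen_lt continuous_const (g y).continuous.norm).mem_nhds ?_
      simp only [Set.mem_ofPred_eq, hg2, RCLike.norm_ofReal, abs_one,
        mem_sphere_zero_iff_norm.1 hy]
      rw [div_lt_one (by linarith)]
      exact hθ)
  refine ⟨s, fun i => g i, fun i => hg1 i, fun y r hr hy => ?_⟩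
  by_cases hy0 : y = 0
  · subst hy0; rw [norm_zero]; positivity
  have hny : 0 < ‖y‖ := norm_pos_iff.2 hy0
  have hmem : ((‖y‖ : 𝕜)⁻¹ • y) ∈ Metric.sphere (0 : V) 1 := by
    rw [mem_sphere_zero_iff_norm, norm_smul, norm_inv, RCLike.norm_ofReal, abs_norm,
      inv_mul_cancel₀ hny.ne']
  obtain ⟨x, hxs, hx⟩ := Set.mem_iUnion₂.1 (hs hmem)
  simp only [Set.mem_ofPred_eq, map_smul, norm_smul, norm_inv, RCLike.norm_ofReal, abs_norm] at hx
  have h1 := hy ⟨x, hxs⟩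
  rw [div_lt_iff₀ (by linarith), mul_assoc, inv_mul_eq_div, lt_div_iff₀ hny, one_mul] at hx
  have h2 := mul_le_mul_of_nonneg_right h1 (by linarith : (0 : ℝ) ≤ θ)
  simp only at h2
  linarith

/-- A projection of a superspace onto an `m`-dimensional space, obtained by extending almost norming
functionals. -/
theorem exists_projection_norm_le {𝕜 : Type*} [RCLike 𝕜] {m : ℕ} {C : ℝ} (hC0 : 0 ≤ C)
    (hC : ∀ (ι : Type u) [Fintype ι] (u : ι → EuclideanSpace 𝕜 (Fin m)),
      (∀ x, ∑ i, ‖inner 𝕜 x (u i)‖ ^ 2 = ‖x‖ ^ 2) → ∀ t : ι → ℝ, (∀ i, 0 ≤ t i) →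
      ∑ i, t i ^ 2 = 1 → ∑ i, ∑ j, t i * t j * ‖inner 𝕜 (u i) (u j)‖ ≤ C)
    {Y : Type u} [NormedAddCommGroup Y] [NormedSpace 𝕜 Y] [FiniteDimensional 𝕜 Y]
    (hY : Module.finrank 𝕜 Y = m) {X : Type*} [NormedAddCommGroup X] [NormedSpace 𝕜 X]
    (φ : Y →ₗᵢ[𝕜] X) {ε : ℝ} (hε : 0 < ε) :
    ∃ P : X →L[𝕜] LinearMap.range φ.toLinearMap,
      (∀ y : LinearMap.range φ.toLinearMap, P (y : X) = y) ∧ ‖P‖ ≤ C + ε := by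
  classical
  -- Half of `ε` pays for the strict minimax bound, the factor `θ` for the imperfect norming.
  set θ := (C + ε) / (C + ε / 2) with hθdef
  have hθ : 1 < θ := by rw [hθdef, one_lt_div (by linarith)]; linarith
  have hθC : θ * (C + ε / 2) = C + ε := div_mul_cancel₀ _ (by linarith)
  obtain ⟨s, f, hf1, hf2⟩ := exists_finset_dual_almost_norming 𝕜 (V := Y) hθ
  let T : Y →ₗ[𝕜] s → 𝕜 := LinearMap.pi fun i => (f i).toLinearMap
  have hTf : ∀ y i, T y i = f i y := fun y i => rfl
  have hT : Function.Injective T := by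
    rw [injective_iff_map_eq_zero]
    intro y hy
    have := hf2 y 0 le_rfl fun i => by rw [← hTf, hy]; simp
    simpa using this
  obtain ⟨R, hR1, hR2⟩ := exists_leftInverse_row_sum_lt (by linarith : C < C + ε / 2) T
    (fun w hw => exists_leftInverse_weighted_sum_le (hC s) hY T hT w hw)
  have hRa : ∀ (a : s → 𝕜) (r : ℝ), 0 ≤ r → (∀ j, ‖a j‖ ≤ r) → ‖R a‖ ≤ (C + ε) * r := by
    intro a r hr ha
    rw [← hθC, mul_assoc]
    refine hf2 _ _ (by positivity) fun i => ?_
    have hexp : f i (R a) = ∑ j, a j * T (R (Pi.single j 1)) i := by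
      conv_lhs => rw [← Finset.univ_sum_single a]
      rw [map_sum, map_sum]
      refine Finset.sum_congr rfl fun j _ => ?_
      have : (Pi.single j (a j) : s → 𝕜) = a j • Pi.single j 1 := by
        rw [← Pi.single_smul]; simp
      rw [this, map_smul, map_smul, smul_eq_mul, hTf]
    rw [hexp]
    calc _ ≤ ∑ j, r * ‖T (R (Pi.single j 1)) i‖ := by
          refine (norm_sum_le _ _).trans (Finset.sum_le_sum fun j _ => ?_)
          rw [norm_mul]
          exact mul_le_mul_of_nonneg_right (ha j) (norm_nonneg _)
      _ ≤ _ := by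
          rw [← Finset.mul_sum, mul_comm]
          exact mul_le_mul_of_nonneg_right (hR2 i).le hr
  let e : Y ≃ₗᵢ[𝕜] LinearMap.range φ.toLinearMap := φ.equivRange
  have he : ∀ y, ((e y : LinearMap.range φ.toLinearMap) : X) = φ y := fun y => rfl
  have hext : ∀ i, ∃ g : StrongDual 𝕜 X, (∀ y, g (φ y) = f i y) ∧ ‖g‖ ≤ 1 := by
    intro i
    obtain ⟨g, hg1, hg2⟩ := exists_extension_norm_eq (LinearMap.range φ.toLinearMap)
      ((f i).comp (e.symm.toContinuousLinearEquiv : LinearMap.range φ.toLinearMap →L[𝕜] Y))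
    refine ⟨g, fun y => ?_, ?_⟩
    · rw [← he, hg1]
      simp
    · rw [hg2]
      refine ContinuousLinearMap.opNorm_le_bound _ zero_le_one fun z => ?_
      refine ((f i).le_of_opNorm_le (hf1 i) _).trans_eq ?_
      simp
  choose g hg1 hg2 using hext
  let P : X →ₗ[𝕜] LinearMap.range φ.toLinearMap :=
    e.toLinearEquiv.toLinearMap ∘ₗ R ∘ₗ LinearMap.pi fun i => (g i).toLinearMap
  have hP : ∀ x, P x = e (R fun i => g i x) := fun x => rfl
  have hbound : ∀ x, ‖P x‖ ≤ (C + ε) * ‖x‖ := by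
    intro x
    rw [hP, e.norm_map]
    exact hRa _ _ (norm_nonneg _) fun j => ((g j).le_of_opNorm_le (hg2 j) x).trans_eq (one_mul _)
  refine ⟨P.mkContinuous (C + ε) hbound, ?_, P.mkContinuous_norm_le (by linarith) hbound⟩
  intro z
  obtain ⟨y, rfl⟩ := e.surjective z
  rw [LinearMap.mkContinuous_apply, hP, he]
  simp only [hg1]
  exact congrArg e (hR1 y)

theorem maxAbsProjConst_le {𝕜 : Type} [RCLike 𝕜] {m : ℕ} {C : ℝ} (hC0 : 0 ≤ C)
    (hC : ∀ (ι : Type u) [Fintype ι] (u : ι → EuclideanSpace 𝕜 (Fin m)),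
      (∀ x, ∑ i, ‖inner 𝕜 x (u i)‖ ^ 2 = ‖x‖ ^ 2) → ∀ t : ι → ℝ, (∀ i, 0 ≤ t i) →
      ∑ i, t i ^ 2 = 1 → ∑ i, ∑ j, t i * t j * ‖inner 𝕜 (u i) (u j)‖ ≤ C) :
    maxAbsProjConst.{u} 𝕜 m ≤ ENNReal.ofReal C := by
  refine iSup_le fun Y => iSup_le fun _ => iSup_le fun _ => iSup_le fun _ => iSup_le fun hY => ?_
  refine iSup_le fun X => iSup_le fun _ => iSup_le fun _ => iSup_le fun _ => iSup_le fun φ => ?_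
  refine ENNReal.le_of_forall_pos_le_add fun ε hε _ => ?_
  obtain ⟨P, hP1, hP2⟩ := exists_projection_norm_le hC0 hC hY φ (NNReal.coe_pos.2 hε)
  refine (iInf₂_le P hP1).trans ?_
  rw [← ofReal_norm, ← ENNReal.ofReal_coe_nnreal, ← ENNReal.ofReal_add hC0 ε.coe_nonneg]
  exact ENNReal.ofReal_le_ofReal hP2

/-! ### Lower bound from equiangular tight frames -/

/-- The identity minus the scaled frame operator is symmetric with zero quadratic form, hence zero;
symmetry makes this valid over ℝ too. -/
theorem eq_smul_sum_inner_smul_of_tight {𝕜 : Type*} [RCLike 𝕜] {ι E : Type*} [Fintype ι]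
    [NormedAddCommGroup E] [InnerProductSpace 𝕜 E] (v : ι → E) (α : ℝ)
    (hv : ∀ x, ‖x‖ ^ 2 = α * ∑ i, ‖inner 𝕜 x (v i)‖ ^ 2) (y : E) :
    y = (α : 𝕜) • ∑ i, inner 𝕜 (v i) y • v i := by
  let F : E →ₗ[𝕜] E := LinearMap.id -
    (α : 𝕜) • ∑ i, (innerₛₗ 𝕜 (v i)).smulRight (v i)
  have hF : ∀ x, F x = x - (α : 𝕜) • ∑ i, inner 𝕜 (v i) x • v i := fun x => by
    simp [F]
  have hFxy : ∀ x y, inner 𝕜 (F x) y =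
      inner 𝕜 x y - α * ∑ i, inner 𝕜 x (v i) * inner 𝕜 (v i) y := fun x y => by
    rw [hF, inner_sub_left, inner_smul_left, sum_inner, RCLike.conj_ofReal]
    simp only [inner_smul_left, inner_conj_symm]
  have hsymm : F.IsSymmetric := fun x y => by
    rw [← inner_conj_symm x, hFxy, hFxy]
    simp only [map_sub, map_mul, map_sum, inner_conj_symm, RCLike.conj_ofReal]
    simp only [mul_comm]
  have h0 : F = 0 := hsymm.inner_map_self_eq_zero.1 fun x => by
    rw [hFxy, inner_self_eq_norm_sq_to_K, ← RCLike.ofReal_pow, hv x, sub_eq_zero]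
    push_cast
    congr 1
    refine Finset.sum_congr rfl fun i _ => ?_
    rw [← RCLike.mul_conj, inner_conj_symm]
  have := hF y
  rw [h0, LinearMap.zero_apply] at this
  exact sub_eq_zero.1 this.symm

/-- The analysis map `x ↦ (⟨v i, x⟩)_i` of a finite system of vectors. -/
noncomputable def analysisMap (𝕜 : Type*) [RCLike 𝕜] {ι E : Type*}
    [NormedAddCommGroup E] [InnerProductSpace 𝕜 E] (v : ι → E) : E →ₗ[𝕜] ι → 𝕜 :=
  LinearMap.pi fun i => innerₛₗ 𝕜 (v i)

theorem analysisMap_apply (𝕜 : Type*) [RCLike 𝕜] {ι E : Type*}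
    [NormedAddCommGroup E] [InnerProductSpace 𝕜 E] (v : ι → E) (x : E) (i : ι) :
    analysisMap 𝕜 v x i = inner 𝕜 (v i) x := rfl

theorem analysisMap_injective_of_tight {𝕜 : Type*} [RCLike 𝕜] {ι E : Type*} [Fintype ι]
    [NormedAddCommGroup E] [InnerProductSpace 𝕜 E] (v : ι → E) (α : ℝ)
    (hv : ∀ x, ‖x‖ ^ 2 = α * ∑ i, ‖inner 𝕜 x (v i)‖ ^ 2) :
    Function.Injective (analysisMap 𝕜 v) := by
  rw [injective_iff_map_eq_zero]
  intro x hx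
  rw [eq_smul_sum_inner_smul_of_tight v α hv x]
  simp [← analysisMap_apply, hx]

theorem sum_apply_single_eq_finrank {𝕜 : Type*} [Field 𝕜] {ι : Type*} [Fintype ι] [DecidableEq ι]
    {W : Submodule 𝕜 (ι → 𝕜)} {Q : (ι → 𝕜) →ₗ[𝕜] ι → 𝕜} (hQ : LinearMap.IsProj W Q) :
    ∑ i, Q (Pi.single i 1) i = Module.finrank 𝕜 W := by
  rw [← hQ.trace, LinearMap.trace_eq_matrix_trace 𝕜 (Pi.basisFun 𝕜 ι)]
  simp [Matrix.trace]

/-- Every projection onto the range of the analysis map of an equiangular tight frame has norm at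
least `δ`. The test matrix is the sign matrix of the Gram matrix. -/
theorem deltaBound_le_norm_projection_of_equiangular {𝕜 : Type*} [RCLike 𝕜] {ι : Type*} [Fintype ι]
    {m : ℕ} (hm : 0 < m) (hmN : m < Fintype.card ι) (v : ι → EuclideanSpace 𝕜 (Fin m))
    (hv1 : ∀ i, ‖v i‖ = 1) {α : ℝ}
    (hv : ∀ x, ‖x‖ ^ 2 = α * ∑ i, ‖inner 𝕜 x (v i)‖ ^ 2) {c : ℝ}
    (hc : ∀ i j, i ≠ j → ‖inner 𝕜 (v i) (v j)‖ = c) {W : Submodule 𝕜 (ι → 𝕜)}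
    (hW : W = LinearMap.range (analysisMap 𝕜 v)) (P : (ι → 𝕜) →L[𝕜] W)
    (hP : ∀ y : W, P (y : ι → 𝕜) = y) : deltaBound m (Fintype.card ι) ≤ ‖P‖ := by
  classical
  set N := Fintype.card ι with hN
  have hm' : (0 : ℝ) < m := by exact_mod_cast hm
  have hmN' : (m : ℝ) < N := by exact_mod_cast hmN
  have hN1 : (1 : ℝ) < N := by exact_mod_cast (by omega : 1 < N)
  have hαN : (m : ℝ) = α * N := by
    simpa [hv1] using sum_norm_sq_of_parseval v α hv
  obtain ⟨i₀, i₁, h01⟩ := Fintype.exists_pair_of_one_lt_card (by omega : 1 < Fintype.card ι)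
  have hc0 : 0 ≤ c := by rw [← hc i₀ i₁ h01]; exact norm_nonneg _
  have hcα : 1 = α * (1 + (N - 1) * c ^ 2) := by
    have h := hv (v i₀)
    rw [← Finset.add_sum_erase _ _ (Finset.mem_univ i₀),
      Finset.sum_congr rfl (fun j hj => by rw [hc i₀ j (Finset.ne_of_mem_erase hj).symm])] at h
    simpa [hv1, Finset.card_erase_of_mem, hN, Nat.cast_sub (by omega : 1 ≤ Fintype.card ι)] using h
  -- The Welch equality; `m < N` then excludes `c = 0`.
  have hcm : c ^ 2 * (m * ((N : ℝ) - 1)) = N - m := by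
    linear_combination (-N : ℝ) * hcα + (c ^ 2 * (N - 1) + 1) * hαN
  have hcpos : 0 < c := by
    refine lt_of_le_of_ne hc0 fun h => ?_
    rw [← h] at hcm
    linarith
  have hfin : Module.finrank 𝕜 W = m := by
    rw [hW, LinearMap.finrank_range_of_inj (analysisMap_injective_of_tight v α hv),
      finrank_euclideanSpace_fin]
  let Q : (ι → 𝕜) →ₗ[𝕜] ι → 𝕜 := W.subtype ∘ₗ P.toLinearMap
  have hQP : ∀ a, Q a = (P a : ι → 𝕜) := fun a => rfl
  have hproj : LinearMap.IsProj W Q :=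
    ⟨fun a => (P a).2, fun a ha => congrArg Subtype.val (hP ⟨a, ha⟩)⟩
  -- These sign vectors combine Gram rows, fixed by `Q`, with basis vectors, on which `Q`
  -- contributes only its trace `m`. So the sum of `Q (a i) i` does not depend on `P`.
  let a : ι → ι → 𝕜 := fun i =>
    ((1 / c : ℝ) : 𝕜) • analysisMap 𝕜 v (v i) + ((1 - 1 / c : ℝ) : 𝕜) • Pi.single i 1
  have ha : ∀ i, ‖a i‖ ≤ 1 := by
    intro i
    refine (pi_norm_le_iff_of_nonneg zero_le_one).2 fun j => ?_
    by_cases hij : j = i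
    · subst hij
      have : a j j = 1 := by
        simp only [a, Pi.add_apply, Pi.smul_apply, analysisMap_apply, inner_self_eq_norm_sq_to_K,
          hv1, Pi.single_eq_same, smul_eq_mul]
        push_cast
        ring
      rw [this, norm_one]
    · simp only [a, Pi.add_apply, Pi.smul_apply, analysisMap_apply, Pi.single_eq_of_ne hij,
          smul_zero, add_zero]
      rw [norm_smul, hc j i hij, RCLike.norm_ofReal, abs_of_pos (by positivity),
        one_div_mul_cancel hcpos.ne']
  have hQa : ∀ i, Q (a i) i =
      ((1 / c : ℝ) : 𝕜) + ((1 - 1 / c : ℝ) : 𝕜) * Q (Pi.single i 1) i := by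
    intro i
    have h1 : Q (analysisMap 𝕜 v (v i)) = analysisMap 𝕜 v (v i) :=
      hproj.map_id _ (hW ▸ LinearMap.mem_range_self _ _)
    simp only [a, map_add, map_smul, h1, Pi.add_apply, Pi.smul_apply, analysisMap_apply,
      inner_self_eq_norm_sq_to_K, hv1, smul_eq_mul]
    simp
  have hsum : ∑ i, Q (a i) i = ((N * (1 / c) + (1 - 1 / c) * m : ℝ) : 𝕜) := by
    simp only [hQa, Finset.sum_add_distrib, ← Finset.mul_sum, sum_apply_single_eq_finrank hproj,
      hfin]
    push_cast
    simp [hN]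
  have hle : N * (1 / c) + (1 - 1 / c) * m ≤ N * ‖P‖ := by
    calc N * (1 / c) + (1 - 1 / c) * m ≤ ‖((N * (1 / c) + (1 - 1 / c) * m : ℝ) : 𝕜)‖ := by
          rw [RCLike.norm_ofReal]; exact le_abs_self _
      _ ≤ ∑ _i : ι, ‖P‖ := by
          rw [← hsum]
          refine (norm_sum_le _ _).trans (Finset.sum_le_sum fun i _ => ?_)
          calc ‖Q (a i) i‖ ≤ ‖P (a i)‖ := norm_le_pi_norm (P (a i) : ι → 𝕜) i
            _ ≤ ‖P‖ := P.unit_le_opNorm _ (ha i)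
      _ = N * ‖P‖ := by simp [hN]
  rw [deltaBound_eq hm (by omega) hc0 hcm]
  refine le_of_mul_le_mul_left (le_trans (le_of_eq ?_) hle) (by linarith : (0 : ℝ) < N)
  field_simp
  linear_combination hcm

theorem deltaBound_le_maxAbsProjConst {𝕜 : Type} [RCLike 𝕜] {m N : ℕ} (hm : 0 < m) (hmN : m < N)
    {v : Fin N → EuclideanSpace 𝕜 (Fin m)} (hv : IsETF 𝕜 v) :
    ENNReal.ofReal (deltaBound m N) ≤ maxAbsProjConst.{u} 𝕜 m := by
  obtain ⟨hv1, ⟨α, -, hv⟩, c, hc⟩ := hv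
  -- Lifting the index set puts the ambient sup-norm space in the universe of the supremum.
  let v' : ULift.{u} (Fin N) → EuclideanSpace 𝕜 (Fin m) := fun i => v i.down
  have hv' : ∀ x, ‖x‖ ^ 2 = α * ∑ i, ‖inner 𝕜 x (v' i)‖ ^ 2 := fun x => by
    rw [hv x, ← Equiv.ulift.{u}.sum_comp (fun i => ‖inner 𝕜 x (v i)‖ ^ 2)]
    rfl
  let Y := LinearMap.range (analysisMap 𝕜 v')
  have hfin : Module.finrank 𝕜 Y = m := by
    rw [LinearMap.finrank_range_of_inj (analysisMap_injective_of_tight v' α hv'),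
      finrank_euclideanSpace_fin]
  have hrange : LinearMap.range Y.subtypeₗᵢ.toLinearMap = LinearMap.range (analysisMap 𝕜 v') :=
    Y.range_subtype
  calc ENNReal.ofReal (deltaBound m N)
      ≤ relProjConst 𝕜 (LinearMap.range Y.subtypeₗᵢ.toLinearMap) := by
        refine le_iInf₂ fun P hP => ?_
        rw [← ofReal_norm]
        refine ENNReal.ofReal_le_ofReal ?_
        have := deltaBound_le_norm_projection_of_equiangular hm (by simpa using hmN) v'
          (fun i => hv1 _) hv' (c := c) (fun i j hij => hc _ _ fun h => hij (ULift.ext _ _ h))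
          hrange P hP
        simpa using this
    _ ≤ absProjConst 𝕜 Y :=
        le_iSup_of_le (ULift.{u} (Fin N) → 𝕜) <| le_iSup_of_le inferInstance <|
          le_iSup_of_le inferInstance <| le_iSup_of_le inferInstance <|
          le_iSup_of_le Y.subtypeₗᵢ le_rfl
    _ ≤ maxAbsProjConst.{u} 𝕜 m :=
        le_iSup_of_le Y <| le_iSup_of_le inferInstance <| le_iSup_of_le inferInstance <|
          le_iSup_of_le inferInstance <| le_iSup_of_le hfin le_rfl

/-! ### Assembly -/

theorem theorem5 (m : ℕ) (hm : 1 < m) :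
    (maxAbsProjConst.{u} ℝ m ≤ ENNReal.ofReal (deltaBound m (m * (m + 1) / 2)) ∧
      deltaBound m (m * (m + 1) / 2) =
        2 / ((m : ℝ) + 1) * (1 + ((m : ℝ) - 1) / 2 * Real.sqrt ((m : ℝ) + 2))) ∧
    (maxAbsProjConst.{u} ℂ m ≤ ENNReal.ofReal (deltaBound m (m ^ 2)) ∧
      deltaBound m (m ^ 2) =
        1 / (m : ℝ) * (1 + ((m : ℝ) - 1) * Real.sqrt ((m : ℝ) + 1))) ∧
    (ExistsMaximalETFReal m →
      maxAbsProjConst.{u} ℝ m = ENNReal.ofReal (deltaBound m (m * (m + 1) / 2))) ∧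
    (ExistsMaximalETFComplex m →
      maxAbsProjConst.{u} ℂ m = ENNReal.ofReal (deltaBound m (m ^ 2))) := by
  have hm' : (1 : ℝ) < m := by exact_mod_cast hm
  have hreal : maxAbsProjConst.{u} ℝ m ≤ ENNReal.ofReal (deltaBound m (m * (m + 1) / 2)) := by
    refine maxAbsProjConst_le ?_ fun ι _ u hu t ht0 ht => sum_mul_norm_inner_le_real hm u hu t ht0 ht
    rw [deltaBound_real hm]
    have : (0 : ℝ) ≤ (m - 1) / 2 := by linarith
    positivity
  have hcomplex : maxAbsProjConst.{u} ℂ m ≤ ENNReal.ofReal (deltaBound m (m ^ 2)) := by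
    refine maxAbsProjConst_le ?_ fun ι _ u hu t ht0 ht =>
      sum_mul_norm_inner_le_complex hm u hu t ht0 ht
    rw [deltaBound_complex hm]
    have : (0 : ℝ) ≤ m - 1 := by linarith
    positivity
  refine ⟨⟨hreal, deltaBound_real hm⟩, ⟨hcomplex, deltaBound_complex hm⟩, ?_, ?_⟩
  · rintro ⟨v, hv⟩
    refine hreal.antisymm (deltaBound_le_maxAbsProjConst (by omega) ?_ hv)
    rw [Nat.lt_iff_add_one_le, Nat.le_div_iff_mul_le (by norm_num)]
    nlinarith
  · rintro ⟨v, hv⟩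
    exact hcomplex.antisymm (deltaBound_le_maxAbsProjConst (by omega) (by nlinarith) hv)
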